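/- Let $\mathcal X$ be a countable set, $\Delta(\mathcal X)$ the set of probability distributions on it, and $\mathcal X^*$ the set of finite sequences. Let $f^\star,\hat f:\mathcal X^*\to\Delta(\mathcal X)$ be an environment and a model; let $X_1,X_2,\dots$ be the process with $X_t\sim Y^\star_t=f^\star(X_1,\dots,X_{t-1})$, and let $\hat Y_t=\hat f(X_1,\dots,X_{t-1})$. Let $a\le b$, $c_\alpha,c_\beta>0$, $\delta\in(0,1)$. Let $\ell$ assign to every weight function $\omega:\mathcal X\to[0,c_\beta]$ a weighted scoring rule $\ell_\omega:\Delta(\mathcal X)\times\mathcal X\to[c_\beta a,c_\beta b]$, and let $\alpha:\mathcal X^*\to[0,c_\alpha]$ and $\beta:\mathcal X^*\to(\mathcal X\to[0,c_\beta])$ be a prediction and an outcome weight function. Write $Z_{i-1}=(X_1,\dots,X_{i-1})$, $t_\alpha=\sum_{i=1}^t\alpha(Z_{i-1})$ and $$F_t=\frac1{t_\alpha}\sum_{i=1}^t\alpha(Z_{i-1})\,\mathbb E_{x\sim Y^\star_i}\big[\ell_{\beta(Z_{i-1})}(\hat Y_i,x)\big].$$ The weighted alignment monitor stores $t_\alpha$,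 $\hat E$, $N$ and the list $z$ of past states, initially $t_\alpha=0$, $\hat E=0$, $N=1$, $z=\epsilon$, and the constant $\sigma=c_\alpha c_\beta(b-a)$. On input $(\hat y,x)$ it sets, in this order, $$w=\alpha(z),\quad s=w\,\ell_{\beta(z)}(\hat y,x),\quad t_\alpha\leftarrow t_\alpha+w,\quad z\leftarrow z\cdot x,\quad N\leftarrow\max\big(1,N+(s-\hat E)^2\big),\quad \hat E\leftarrow\frac{(t_\alpha-w)\hat E+s}{t_\alpha}$$ ($\hat E$ stays $0$ as long as $t_\alpha=0$) and returns $[\hat E-\varepsilon,\hat E+\varepsilon]$, where $$\varepsilon=\frac{\sqrt{2.13\,N\,g+1.76\,\sigma^2g^2}+1.33\,\sigma\,g}{t_\alpha},\qquad g=2\log\!\Big(\frac{\pi\log(eN)}{\sqrt6}\Big)+\log\frac2\delta .$$ Theorem. (1) With probability at least $1-\delta$, the interval returned by the monitor after reading $(\hat Y_1,X_1),\dots,(\hat Y_t,X_t)$ contains $F_t$ simultaneously for all $t\ge1$ with $t_\alpha>0$. The same holds with $\log N$ in place of $\log(eN)$ in $g$, simultaneously for all $t\ge 1$ with $t_\alpha>0$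 and $N\ge e$. (2) Let the monitor run on a real random-access machine with unit-cost arithmetic ($+,-,\cdot,/,\max,\sqrt{\ },\log$), on which evaluating $\alpha(z)$ and $\beta(z)$ takes time at most $K(|z|+1)$ and evaluating $\ell_\omega(y,x)$ takes time at most $T_{\ell,\mathcal X}$. Then the iteration at time $t$ takes at most $C\,(t+T_{\ell,\mathcal X})$ time and uses at most $C\,t$ memory cells (registers, stored history, evaluation stack), where $C$ depends only on $K$. -/

import Mathlib

open MeasureTheory

namespace AlignmentMonitor

/-! ### The processes defined by an environment and a model

Finite sequences `x₁, …, x_t` over the countable state space `𝒳` are lists, oldest state first;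
distributions over `𝒳` are `PMF 𝒳`. A process is indexed from zero: `X i` is the `(i+1)`-st state. -/

/-- The sequence of states `X₁, …, X_t` at the outcome `ω`. -/
def past {Ω 𝒳 : Type*} (X : ℕ → Ω → 𝒳) (t : ℕ) (ω : Ω) : List 𝒳 :=
  (List.range t).map fun i => X i ω

/-- `X` is the stochastic process defined by the environment `env`: given the past, the next state
is sampled from `env (past)`. On a countable state space this is a statement about the law of `X`,
given by the probabilities of the finite paths. -/
def IsGeneratedBy {Ω 𝒳 : Type*} [MeasurableSpace Ω] [MeasurableSpace 𝒳]
    (env : List 𝒳 → PMF 𝒳) (P : Measure Ω) (X : ℕ → Ω → 𝒳) : Prop :=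
  (∀ i, Measurable (X i)) ∧
    ∀ (t : ℕ) (x : ℕ → 𝒳),
      P {ω | ∀ i < t, X i ω = x i} =
        ∏ i ∈ Finset.range t, env ((List.range i).map x) (x i)

/-- The observed history `(Ŷ₁, X₁), …, (Ŷ_t, X_t)`, with `Ŷ_i` the prediction of the model. -/
def observedHistory {Ω 𝒳 : Type*} (model : List 𝒳 → PMF 𝒳) (X : ℕ → Ω → 𝒳) (t : ℕ) (ω : Ω) :
    List (PMF 𝒳 × 𝒳) :=
  (List.range t).map fun i => (model (past X i ω), X i ω)

/-- The hidden history with the observed states, `(Ŷ₁, Y⋆₁, X₁), …, (Ŷ_t, Y⋆_t, X_t)`. -/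
def hiddenHistory {Ω 𝒳 : Type*} (env model : List 𝒳 → PMF 𝒳) (X : ℕ → Ω → 𝒳) (t : ℕ) (ω : Ω) :
    List (PMF 𝒳 × PMF 𝒳 × 𝒳) :=
  (List.range t).map fun i => (model (past X i ω), env (past X i ω), X i ω)

/-! ### The weighted average expected score -/

/-- The weighted time `t_α(z) = ∑_{i=1}^t α(z_{1:i-1})` of a sequence `z` of length `t`. -/
noncomputable def weightedTime {𝒳 : Type*} (α : List 𝒳 → ℝ) (z : List 𝒳) : ℝ :=
  ∑ i ∈ Finset.range z.length, α (z.take i)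

/-- The weighted average expected score
`(1 / t_α(z)) * ∑_{i=1}^t α(z_{1:i-1}) * 𝔼_{x ∼ y⋆_i} [ℓ_{β(z_{1:i-1})}(ŷ_i, x)]`
of a history `(ŷ₁, y⋆₁, x₁), …, (ŷ_t, y⋆_t, x_t)` with state sequence `z = x₁, …, x_t`. It is
meaningful when `t_α(z) > 0`. The weighted scoring rule `ℓ_ω(y, x)` is `ℓ ω y x`. -/
noncomputable def weightedExpectedScore {𝒳 : Type*} [MeasurableSpace 𝒳]
    (ℓ : (𝒳 → ℝ) → PMF 𝒳 → 𝒳 → ℝ) (α : List 𝒳 → ℝ) (β : List 𝒳 → 𝒳 → ℝ)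
    (v : List (PMF 𝒳 × PMF 𝒳 × 𝒳)) : ℝ :=
  (1 / weightedTime α (v.map fun e => e.2.2)) *
    ∑ i : Fin v.length,
      α ((v.take i).map fun e => e.2.2) *
        ∫ x, ℓ (β ((v.take i).map fun e => e.2.2)) v[i].1 x ∂(v[i].2.1.toMeasure)

/-! ### A real random-access machine with a history list

The machine has finitely many real registers and one list of states that grows by appending. One
iteration runs a straight-line program; an instruction assigns an expression to a register or
appends the current state to the list. Arithmetic, comparison, square root and logarithm are unit
cost. The prediction weight and the weighted score are evaluated by supplied subroutines. -/

/-- The registers. -/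
inductive Reg
  | time | mean | var | sigma | weight | score | g | eps | lower | upper
  deriving DecidableEq

instance : Fintype Reg where
  elems := {.time, .mean, .var, .sigma, .weight, .score, .g, .eps, .lower, .upper}
  complete r := by cases r <;> decide

/-- Arithmetic expressions. `predWeight` is `α(z)` and `weightedScore` is `ℓ_{β(z)}(ŷ, x)`, where
`z` is the content of the list and `(ŷ, x)` the current input. -/
inductive Expr
  | reg (r : Reg)
  | const (c : ℝ)
  | add (e₁ e₂ : Expr)
  | sub (e₁ e₂ : Expr)
  | mul (e₁ e₂ : Expr)
  | div (e₁ e₂ : Expr)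
  | max (e₁ e₂ : Expr)
  | sqrt (e : Expr)
  | log (e : Expr)
  | predWeight
  | weightedScore

instance : Add Expr := ⟨Expr.add⟩
instance : Sub Expr := ⟨Expr.sub⟩
instance : Mul Expr := ⟨Expr.mul⟩
instance : Div Expr := ⟨Expr.div⟩

/-- Instructions: assign the value of an expression to a register, or append the current state `x`
to the list. -/
inductive Instr
  | assign (r : Reg) (e : Expr)
  | append

/-- A configuration of the machine: the registers and the list of states. -/
structure State (𝒳 : Type*) where
  reg : Reg → ℝ
  list : List 𝒳

section Semantics

variable {𝒳 : Type*} (ℓ : (𝒳 → ℝ) → PMF 𝒳 → 𝒳 → ℝ) (α : List 𝒳 → ℝ) (β : List 𝒳 → 𝒳 → ℝ)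

/-- The value of an expression on the input `(ŷ, x) = i`. -/
noncomputable def Expr.eval (i : PMF 𝒳 × 𝒳) (S : State 𝒳) : Expr → ℝ
  | .reg r => S.reg r
  | .const c => c
  | .add e₁ e₂ => e₁.eval i S + e₂.eval i S
  | .sub e₁ e₂ => e₁.eval i S - e₂.eval i S
  | .mul e₁ e₂ => e₁.eval i S * e₂.eval i S
  | .div e₁ e₂ => e₁.eval i S / e₂.eval i S
  | .max e₁ e₂ => Max.max (e₁.eval i S) (e₂.eval i S)
  | .sqrt e => Real.sqrt (e.eval i S)
  | .log e => Real.log (e.eval i S)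
  | .predWeight => α S.list
  | .weightedScore => ℓ (β S.list) i.1 i.2

/-- The effect of one instruction. -/
noncomputable def Instr.exec (i : PMF 𝒳 × 𝒳) (S : State 𝒳) : Instr → State 𝒳
  | .assign r e => { S with reg := Function.update S.reg r (e.eval ℓ α β i S) }
  | .append => { S with list := S.list ++ [i.2] }

/-- The effect of a straight-line program. -/
noncomputable def runProgram (i : PMF 𝒳 × 𝒳) (prog : List Instr) (S : State 𝒳) : State 𝒳 :=
  prog.foldl (fun S c => c.exec ℓ α β i S) S

end Semantics

/-- The running times of the supplied subroutines: `predTime z` for evaluating `α(z)`, `outTime z`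
for obtaining the weight function `β(z)`, and `scoreTime ω y x` for evaluating `ℓ_ω(y, x)`. -/
structure SubroutineTimes (𝒳 : Type*) where
  predTime : List 𝒳 → ℕ
  outTime : List 𝒳 → ℕ
  scoreTime : (𝒳 → ℝ) → PMF 𝒳 → 𝒳 → ℕ

section Cost

variable {𝒳 : Type*} (ℓ : (𝒳 → ℝ) → PMF 𝒳 → 𝒳 → ℝ) (α : List 𝒳 → ℝ) (β : List 𝒳 → 𝒳 → ℝ)
  (τ : SubroutineTimes 𝒳)

/-- The number of steps for evaluating an expression. -/
def Expr.steps (i : PMF 𝒳 × 𝒳) (S : State 𝒳) : Expr → ℕ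
  | .reg _ => 1
  | .const _ => 1
  | .add e₁ e₂ => e₁.steps i S + e₂.steps i S + 1
  | .sub e₁ e₂ => e₁.steps i S + e₂.steps i S + 1
  | .mul e₁ e₂ => e₁.steps i S + e₂.steps i S + 1
  | .div e₁ e₂ => e₁.steps i S + e₂.steps i S + 1
  | .max e₁ e₂ => e₁.steps i S + e₂.steps i S + 1
  | .sqrt e => e.steps i S + 1
  | .log e => e.steps i S + 1
  | .predWeight => τ.predTime S.list + 1
  | .weightedScore => τ.outTime S.list + τ.scoreTime (β S.list) i.1 i.2 + 1

/-- The number of real-valued stack cells for evaluating an expression. -/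
def Expr.stack : Expr → ℕ
  | .reg _ => 1
  | .const _ => 1
  | .add e₁ e₂ => Max.max e₁.stack (e₂.stack + 1)
  | .sub e₁ e₂ => Max.max e₁.stack (e₂.stack + 1)
  | .mul e₁ e₂ => Max.max e₁.stack (e₂.stack + 1)
  | .div e₁ e₂ => Max.max e₁.stack (e₂.stack + 1)
  | .max e₁ e₂ => Max.max e₁.stack (e₂.stack + 1)
  | .sqrt e => e.stack
  | .log e => e.stack
  | .predWeight => 1
  | .weightedScore => 1

/-- The number of steps of one instruction. -/
def Instr.steps (i : PMF 𝒳 × 𝒳) (S : State 𝒳) : Instr → ℕ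
  | .assign _ e => e.steps β τ i S + 1
  | .append => 1

/-- The number of memory cells in use while one instruction is executed: the registers, the list
of states, and the evaluation stack. -/
def Instr.cells (S : State 𝒳) : Instr → ℕ
  | .assign _ e => Fintype.card Reg + S.list.length + e.stack
  | .append => Fintype.card Reg + (S.list.length + 1)

/-- The running time of a program from the configuration `S` on the input `i`. -/
noncomputable def programTime (i : PMF 𝒳 × 𝒳) : List Instr → State 𝒳 → ℕ
  | [], _ => 0
  | c :: prog, S => c.steps β τ i S + programTime i prog (c.exec ℓ α β i S)

/-- The peak number of memory cells in use during the run of a program from the configuration `S`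
on the input `i`. -/
noncomputable def programSpace (i : PMF 𝒳 × 𝒳) : List Instr → State 𝒳 → ℕ
  | [], S => Fintype.card Reg + S.list.length
  | c :: prog, S => Max.max (c.cells S) (programSpace i prog (c.exec ℓ α β i S))

end Cost

/-! ### The weighted alignment monitor -/

open AlignmentMonitor.Expr in
/-- One iteration of the monitor. The parameter `κ` is the factor inside the iterated logarithm:
`g = 2 log (π log (κ N) / √6) + log (2 / δ)`. -/
noncomputable def monitorProgram (κ δ : ℝ) : List Instr :=
  [ .assign .weight predWeight,
    .assign .score (reg .weight * weightedScore),
    .assign .time (reg .time + reg .weight),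
    .append,
    .assign .var (Expr.max (const 1)
      (reg .var + (reg .score - reg .mean) * (reg .score - reg .mean))),
    .assign .mean
      (const 1 / reg .time * ((reg .time - reg .weight) * reg .mean + reg .score)),
    .assign .g (const 2 * log (const Real.pi * log (const κ * reg .var) / sqrt (const 6)) +
      log (const 2 / const δ)),
    .assign .eps
      ((sqrt (const 2.13 * reg .var * reg .g +
          const 1.76 * (reg .sigma * reg .sigma) * (reg .g * reg .g)) +
        const 1.33 * reg .sigma * reg .g) / reg .time),
    .assign .lower (reg .mean - reg .eps),
    .assign .upper (reg .mean + reg .eps) ]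

/-- The initial configuration: `N = 1`, the bound `σ = c_α c_β (b - a)`, all other registers zero,
and the empty list. -/
noncomputable def initialState (𝒳 : Type*) (a b cα cβ : ℝ) : State 𝒳 where
  reg
    | .var => 1
    | .sigma => cα * cβ * (b - a)
    | _ => 0
  list := []

section Monitor

variable {𝒳 : Type*} (ℓ : (𝒳 → ℝ) → PMF 𝒳 → 𝒳 → ℝ) (α : List 𝒳 → ℝ) (β : List 𝒳 → 𝒳 → ℝ)
  (a b cα cβ κ δ : ℝ)

/-- The configuration of the monitor after reading an observed history. -/
noncomputable def monitorState (w : List (PMF 𝒳 × 𝒳)) : State 𝒳 :=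
  w.foldl (fun S i => runProgram ℓ α β i (monitorProgram κ δ) S) (initialState 𝒳 a b cα cβ)

/-- The interval `[Ê - ε, Ê + ε]` that the monitor returns on an observed history. -/
noncomputable def weightedMonitor (w : List (PMF 𝒳 × 𝒳)) : Set ℝ :=
  Set.Icc ((monitorState ℓ α β a b cα cβ κ δ w).reg .lower)
    ((monitorState ℓ α β a b cα cβ κ δ w).reg .upper)

/-- The running time of the iteration that reads the input `i` after the history `w`. -/
noncomputable def iterationTime (τ : SubroutineTimes 𝒳) (w : List (PMF 𝒳 × 𝒳))
    (i : PMF 𝒳 × 𝒳) : ℕ :=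
  programTime ℓ α β τ i (monitorProgram κ δ) (monitorState ℓ α β a b cα cβ κ δ w)

/-- The memory in use during the iteration that reads the input `i` after the history `w`. -/
noncomputable def iterationSpace (w : List (PMF 𝒳 × 𝒳)) (i : PMF 𝒳 × 𝒳) : ℕ :=
  programSpace ℓ α β i (monitorProgram κ δ) (monitorState ℓ α β a b cα cβ κ δ w)

end Monitor

end AlignmentMonitor

open AlignmentMonitor

namespace AlignmentMonitor

/-! Soundness is a time-uniform empirical Bernstein bound. Let `D` be the sum of the deviations of
the weighted scores from their conditional means and `V` the sum of their squared distances to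
predictable guesses. With `c` a bound on the range of a score, `exp (θ / (1 + c θ) * (D - θ / 2 *
V))` is a supermartingale for every `θ ≥ 0` (`lintegral_exp_empirical_bernstein_le_one`). Being at
least `exp r` means `D ≥ r / θ + c r + θ V / 2`.

No single `θ` is good for all `V`, so the range of `N = 1 + V` is cut into epochs `exp k ≤ κ N ≤ exp
(k + 1)`, each with the `θ` optimal at its geometric centre. The epochs get weights proportional to
`1 / k ^ 2`, and the weighted sum over epochs and both signs of `D` is a supermartingale that starts
at `δ`. By Ville's inequality (`IsGeneratedBy.measure_exists_one_le`) it reaches one with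
probability at most `δ`; by `one_le_mixtureProcess` it does so whenever `|D|` exceeds the boundary
of the monitor. Since `|D|` is the weighted time multiplied by the distance between the estimate and
the target, this is soundness.

The cost bounds are a count over a program of fixed length. -/

/-! ### Elementary inequalities and one step of the supermartingale. -/

theorem sub_sq_le_log_one_add {x u : ℝ} (hx0 : 0 ≤ x) (hx : x < 1) (hu : -x ≤ u) :
    u - u ^ 2 / (2 * (1 - x)) ≤ Real.log (1 + u) := by
  rcases le_or_gt 0 u with h | h
  · refine le_trans ?_ (Real.le_log_one_add_of_nonneg h)
    have h1 : u ^ 2 / 2 ≤ u ^ 2 / (2 * (1 - x)) := by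
      apply div_le_div_of_nonneg_left (sq_nonneg u) (by linarith) (by linarith)
    have h2 : u - u ^ 2 / 2 ≤ 2 * u / (u + 2) := by
      rw [le_div_iff₀ (by linarith)]
      nlinarith [pow_nonneg h 3]
    linarith
  · have hpos : 0 < 1 + u := by linarith
    have h1 : u ^ 2 / (2 * (1 + u)) ≤ u ^ 2 / (2 * (1 - x)) := by
      apply div_le_div_of_nonneg_left (sq_nonneg u) (by linarith) (by linarith)
    have hlog : 0 ≤ -Real.log (1 + u) := by
      have := Real.log_nonpos hpos.le (by linarith); linarith
    -- For negative `u`, `y ≤ sinh y` at `y = -log (1 + u)` gives the bound with `1 + u` in place of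
    -- `1 - x`.
    have h2 := Real.self_le_sinh_iff.2 hlog
    rw [Real.sinh_eq, neg_neg, Real.exp_neg, Real.exp_log hpos] at h2
    have h3 : ((1 + u)⁻¹ - (1 + u)) / 2 = -(u - u ^ 2 / (2 * (1 + u))) := by
      field_simp; ring
    linarith

/-- The parameter `θ / (1 + c * θ)` is chosen so that the logarithmic bound at `x = c * θ / (1 + c *
θ)`, where `1 - x = 1 / (1 + c * θ)`, has exactly the quadratic coefficient `θ / 2`. -/
theorem exp_sub_sq_le_one_add {c θ y : ℝ} (hc : 0 ≤ c) (hθ : 0 ≤ θ) (hy : -c ≤ y) :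
    Real.exp (θ / (1 + c * θ) * (y - θ / 2 * y ^ 2)) ≤ 1 + θ / (1 + c * θ) * y := by
  have hd : 0 < 1 + c * θ := by positivity
  have hx : 1 - c * θ / (1 + c * θ) = 1 / (1 + c * θ) := by field_simp; ring
  have hu : -(c * θ / (1 + c * θ)) ≤ θ / (1 + c * θ) * y := by
    have : θ / (1 + c * θ) * (-c) ≤ θ / (1 + c * θ) * y :=
      mul_le_mul_of_nonneg_left hy (by positivity)
    calc _ = θ / (1 + c * θ) * (-c) := by ring
      _ ≤ _ := this
  have hx1 : c * θ / (1 + c * θ) < 1 := by rw [div_lt_one hd]; linarith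
  have h := sub_sq_le_log_one_add (by positivity) hx1 hu
  have hpos : 0 < 1 + θ / (1 + c * θ) * y := by linarith
  rw [← Real.le_log_iff_exp_le hpos]
  refine le_trans (le_of_eq ?_) h
  rw [hx]
  field_simp

/-- One step of the empirical Bernstein supermartingale: the prediction `p` of `Y` is arbitrary. -/
theorem lintegral_exp_empirical_bernstein_le_one {S : Type*} [MeasurableSpace S]
    (ν : Measure S) [IsProbabilityMeasure ν] {Y : S → ℝ} (hYm : Measurable Y) {A B c θ : ℝ}
    (p : ℝ) (hθ : 0 ≤ θ) (hAB : B - A ≤ c) (hY : ∀ x, Y x ∈ Set.Icc A B) :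
    ∫⁻ x, ENNReal.ofReal (Real.exp (θ / (1 + c * θ) *
      ((Y x - ∫ y, Y y ∂ν) - θ / 2 * (Y x - p) ^ 2))) ∂ν ≤ 1 := by
  obtain ⟨x₀⟩ : Nonempty S := nonempty_of_isProbabilityMeasure ν
  have hAB' : A ≤ B := (hY x₀).1.trans (hY x₀).2
  have hc : 0 ≤ c := by linarith
  set lam := θ / (1 + c * θ) with hlam
  have hlam0 : 0 ≤ lam := by positivity
  set m := ∫ y, Y y ∂ν with hm
  -- The guess is clipped to the range of `Y`: this only decreases the squared error and makes `Y -
  -- q ≥ -c`. The running mean needs this, since it averages per unit of weight and may lie outside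
  -- the range of the next weighted score.
  set q := max A (min p B) with hq
  have hqA : A ≤ q := le_max_left _ _
  have hqB : q ≤ B := max_le hAB' (min_le_right _ _)
  have hint : Integrable Y ν := Integrable.of_bound hYm.aestronglyMeasurable (max |A| |B|)
    (Filter.Eventually.of_forall fun x => by
      rw [Real.norm_eq_abs]; exact abs_le_max_abs_abs (hY x).1 (hY x).2)
  have hsq : ∀ x, (Y x - q) ^ 2 ≤ (Y x - p) ^ 2 := by
    intro x
    obtain ⟨h1, h2⟩ := hY x
    rcases le_total p A with h | h
    · have : q = A := by rw [hq, min_eq_left (h.trans hAB'), max_eq_left h]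
      rw [this]; nlinarith
    · rcases le_total p B with h' | h'
      · have : q = p := by rw [hq, min_eq_left h', max_eq_right h]
        rw [this]
      · have : q = B := by rw [hq, min_eq_right h', max_eq_right hAB']
        rw [this]; nlinarith
  have hpt : ∀ x, Real.exp (lam * ((Y x - m) - θ / 2 * (Y x - p) ^ 2)) ≤
      Real.exp (-(lam * (m - q))) * (1 + lam * (Y x - q)) := by
    intro x
    have h1 := exp_sub_sq_le_one_add (y := Y x - q) hc hθ (by linarith [(hY x).1])
    rw [← hlam] at h1
    refine le_trans ?_ (mul_le_mul_of_nonneg_left h1 (Real.exp_pos _).le)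
    rw [← Real.exp_add]
    apply Real.exp_le_exp.2
    have := mul_le_mul_of_nonneg_left (hsq x) (by positivity : 0 ≤ lam * (θ / 2))
    nlinarith
  have hnn : ∀ x, 0 ≤ Real.exp (-(lam * (m - q))) * (1 + lam * (Y x - q)) :=
    fun x => (Real.exp_pos _).le.trans (hpt x)
  have hint2 : Integrable (fun x => Real.exp (-(lam * (m - q))) * (1 + lam * (Y x - q))) ν := by
    fun_prop
  calc _ ≤ ∫⁻ x, ENNReal.ofReal (Real.exp (-(lam * (m - q))) * (1 + lam * (Y x - q))) ∂ν :=
        lintegral_mono fun x => ENNReal.ofReal_le_ofReal (hpt x)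
    _ = ENNReal.ofReal (∫ x, Real.exp (-(lam * (m - q))) * (1 + lam * (Y x - q)) ∂ν) :=
        (ofReal_integral_eq_lintegral_ofReal hint2 (Filter.Eventually.of_forall hnn)).symm
    _ ≤ 1 := by
      rw [ENNReal.ofReal_le_one, integral_const_mul, integral_add (by fun_prop) (by fun_prop),
        integral_const_mul, integral_sub hint (by fun_prop), ← hm]
      simp only [integral_const, probReal_univ, one_smul]
      have h1 := Real.add_one_le_exp (lam * (m - q))
      calc _ ≤ Real.exp (-(lam * (m - q))) * Real.exp (lam * (m - q)) :=
            mul_le_mul_of_nonneg_left (by linarith) (Real.exp_pos _).le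
        _ = 1 := by rw [← Real.exp_add]; simp

/-- The boundary of the epoch `v ∈ [u / √e, √e u]` of the variance process. -/
theorem stitched_boundary_le {r v u : ℝ} (hr : 0 < r) (hv : 0 < v) (hu : 0 < u)
    (h1 : u ≤ Real.exp (1 / 2) * v) (h2 : v ≤ Real.exp (1 / 2) * u) :
    r / √(2 * r / u) + √(2 * r / u) / 2 * v ≤ √(2.13 * v * r) := by
  set s := Real.exp (1 / 2) with hs
  have hss : s * s = Real.exp 1 := by rw [hs, ← Real.exp_add]; norm_num
  have hs0 : 0 < s := Real.exp_pos _
  have he1 := Real.exp_one_gt_d9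
  have he2 := Real.exp_one_lt_d9
  have hs1 : 1.6487 < s := by nlinarith
  have hs2 : s < 1.6488 := by nlinarith
  have hs3 : s + 1 / s ≤ 2.26 := by
    have : 1 / s ≤ 1 / 1.6487 := one_div_le_one_div_of_le (by norm_num) hs1.le
    have h' : (1 : ℝ) / 1.6487 < 0.6066 := by norm_num
    linarith
  have ht : 0 < √(2 * r / u) := Real.sqrt_pos.2 (by positivity)
  have htt : √(2 * r / u) * √(2 * r / u) = 2 * r / u := Real.mul_self_sqrt (by positivity)
  apply Real.le_sqrt_of_sq_le
  have e1 : r / √(2 * r / u) = √(2 * r / u) * (u / 2) := by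
    rw [div_eq_iff ht.ne']
    have : √(2 * r / u) * (u / 2) * √(2 * r / u) = 2 * r / u * (u / 2) := by
      rw [mul_right_comm, htt]
    rw [this]; field_simp
  rw [e1]
  have e2 : (√(2 * r / u) * (u / 2) + √(2 * r / u) / 2 * v) ^ 2
      = (√(2 * r / u) * √(2 * r / u)) * (u + v) ^ 2 / 4 := by ring
  rw [e2, htt]
  -- The ratio `u / v` lies between `1 / s` and `s`, so `u / v + v / u ≤ s + 1 / s`. The constant
  -- 2.13 is `(2.26 + 2) / 2`.
  have key : u ^ 2 + v ^ 2 ≤ 2.26 * (u * v) := by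
    have h3 : (u - s * v) * (u - v / s) ≤ 0 := by
      apply mul_nonpos_of_nonpos_of_nonneg (by linarith)
      rw [sub_nonneg, div_le_iff₀ hs0]; linarith
    have h4 : (u - s * v) * (u - v / s) = u ^ 2 + v ^ 2 - (s + 1 / s) * (u * v) := by
      field_simp; ring
    have := mul_le_mul_of_nonneg_right hs3 (by positivity : 0 ≤ u * v)
    linarith
  rw [show 2 * r / u * (u + v) ^ 2 / 4 = (r / (2 * u)) * (u + v) ^ 2 by field_simp; ring]
  rw [div_mul_eq_mul_div, div_le_iff₀ (by positivity)]
  nlinarith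

/-! ### Sums along finite sequences. -/

/-- The sum `∑ i, f (z₁, …, z_i) z_{i+1}` along a finite sequence `z`. -/
noncomputable def pathSum {𝒳 : Type*} (f : List 𝒳 → 𝒳 → ℝ) (z : List 𝒳) : ℝ :=
  (z.foldl (fun p x => (p.1 ++ [x], p.2 + f p.1 x)) (([] : List 𝒳), (0 : ℝ))).2

theorem foldl_append_fst {𝒳 : Type*} (f : List 𝒳 → 𝒳 → ℝ) (z : List 𝒳) :
    (z.foldl (fun p x => (p.1 ++ [x], p.2 + f p.1 x)) (([] : List 𝒳), (0 : ℝ))).1 = z := by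
  induction z using List.reverseRecOn with
  | nil => rfl
  | append_singleton z x ih => simp [List.foldl_append, ih]

@[simp]
theorem pathSum_nil {𝒳 : Type*} (f : List 𝒳 → 𝒳 → ℝ) : pathSum f [] = 0 := rfl

@[simp]
theorem pathSum_append_singleton {𝒳 : Type*} (f : List 𝒳 → 𝒳 → ℝ) (z : List 𝒳) (x : 𝒳) :
    pathSum f (z ++ [x]) = pathSum f z + f z x := by
  simp [pathSum, List.foldl_append, foldl_append_fst]

@[simp]
theorem weightedTime_append_singleton {𝒳 : Type*} (α : List 𝒳 → ℝ) (z : List 𝒳) (x : 𝒳) :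
    weightedTime α (z ++ [x]) = weightedTime α z + α z := by
  simp only [weightedTime, List.length_append, List.length_singleton, Finset.sum_range_succ]
  congr 1
  · refine Finset.sum_congr rfl fun i hi => ?_
    rw [List.take_append_of_le_length (Finset.mem_range.1 hi).le]
  · simp

theorem past_succ {Ω 𝒳 : Type*} (X : ℕ → Ω → 𝒳) (t : ℕ) (ω : Ω) :
    past X (t + 1) ω = past X t ω ++ [X t ω] := by
  simp [past, List.range_succ]

theorem length_past {Ω 𝒳 : Type*} (X : ℕ → Ω → 𝒳) (t : ℕ) (ω : Ω) :
    (past X t ω).length = t := by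
  simp [past]

theorem past_eq_and_eq_iff {Ω 𝒳 : Type*} (X : ℕ → Ω → 𝒳) (z : List 𝒳) (x : 𝒳) (ω : Ω) :
    (∀ i < z.length + 1, X i ω = (z ++ [x]).getD i x) ↔
      past X z.length ω = z ∧ X z.length ω = x := by
  have h0 : (z ++ [x]).getD z.length x = x := by simp [List.getD]
  have h1 : past X z.length ω = z ↔ ∀ i < z.length, X i ω = (z ++ [x]).getD i x := by
    constructor
    · intro h i hi
      have : (past X z.length ω)[i]? = z[i]? := by rw [h]
      simp [past, hi] at this
      simp [List.getD, hi, List.getElem?_append_left, this]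
    · intro h
      apply List.ext_getElem (length_past X _ ω)
      intro i hi hi'
      have := h i hi'
      simp only [List.getD, List.getElem?_append_left hi', List.getElem?_eq_getElem hi',
        Option.getD_some] at this
      simp [past, this]
  rw [h1]
  constructor
  · intro h
    exact ⟨fun i hi => h i (by omega), by rw [h _ (by omega), h0]⟩
  · rintro ⟨h, h'⟩ i hi
    rcases Nat.lt_succ_iff_lt_or_eq.1 hi with h2 | rfl
    · exact h i h2
    · rw [h', h0]

theorem map_range_getD_append {𝒳 : Type*} (z : List 𝒳) (x : 𝒳) :
    (List.range z.length).map (fun i => (z ++ [x]).getD i x) = z := by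
  apply List.ext_getElem (by simp)
  intro i hi hi'
  simp [List.getElem?_append_left hi', hi']

/-! ### The law of the past and Ville's inequality. -/

open Classical in
/-- The function `M` on finite sequences, stopped at level one. -/
noncomputable def stopAtOne {𝒳 : Type*} (M : List 𝒳 → ENNReal) (z : List 𝒳) : ENNReal :=
  if ∃ y, y <+: z ∧ 1 ≤ M y then 1 else M z

section GeneratedPaths

variable {Ω 𝒳 : Type*} [MeasurableSpace Ω] [MeasurableSpace 𝒳]

theorem measurableSet_past_eq [DiscreteMeasurableSpace 𝒳] {X : ℕ → Ω → 𝒳}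
    (hX : ∀ i, Measurable (X i)) (t : ℕ) (z : List 𝒳) : MeasurableSet {ω | past X t ω = z} := by
  induction t generalizing z with
  | zero => simp [past]
  | succ t ih =>
    rcases List.eq_nil_or_concat z with rfl | ⟨y, x, rfl⟩
    · simp [past_succ]
    · have : {ω | past X (t + 1) ω = y.concat x} = {ω | past X t ω = y} ∩ X t ⁻¹' {x} := by
        ext ω
        simp [past_succ]
      rw [this]
      exact (ih y).inter (hX t (measurableSet_singleton x))

theorem IsGeneratedBy.measure_past_eq_and {env : List 𝒳 → PMF 𝒳} {P : Measure Ω}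
    {X : ℕ → Ω → 𝒳} (h : IsGeneratedBy env P X) (t : ℕ) (z : List 𝒳) (x : 𝒳) :
    P {ω | past X t ω = z ∧ X t ω = x} = P {ω | past X t ω = z} * env z x := by
  by_cases hz : z.length = t
  · subst hz
    -- Path probabilities are stated for infinite sequences, so `z ++ [x]` is padded with `x`; the
    -- padding is never read.
    have h1 := h.2 (z.length + 1) (fun i => (z ++ [x]).getD i x)
    have h2 := h.2 z.length (fun i => (z ++ [x]).getD i x)
    simp only [past_eq_and_eq_iff] at h1
    rw [h1, Finset.prod_range_succ, ← h2, map_range_getD_append]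
    have h0 : (z ++ [x]).getD z.length x = x := by simp [List.getD]
    have h3 : {ω | ∀ i < z.length, X i ω = (z ++ [x]).getD i x} =
        {ω | past X z.length ω = z} := by
      ext ω
      constructor
      · intro hω
        simp only [Set.mem_ofPred_eq] at hω ⊢
        rw [← map_range_getD_append z x]
        simp only [past, List.length_map, List.length_range]
        exact List.map_congr_left fun i hi => hω i (List.mem_range.1 hi)
      · intro hω i hi
        have : (past X z.length ω)[i]? = z[i]? := by rw [hω]
        simp [past, hi] at this
        simp [List.getD, hi, List.getElem?_append_left, this]
    rw [h3, h0]
  · have h1 : ∀ ω, past X t ω ≠ z := fun ω hω => hz (by rw [← hω, length_past])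
    simp [h1]

variable [Countable 𝒳] [DiscreteMeasurableSpace 𝒳]

/-- The Markov kernel form of the path probabilities. There are countably many finite sequences, so
both sides are sums over them and no conditional expectation is needed. -/
theorem IsGeneratedBy.lintegral_past_succ {env : List 𝒳 → PMF 𝒳} {P : Measure Ω}
    {X : ℕ → Ω → 𝒳} (h : IsGeneratedBy env P X) (t : ℕ) (f : List 𝒳 → ENNReal) :
    ∫⁻ ω, f (past X (t + 1) ω) ∂P =
      ∫⁻ ω, ∫⁻ x, f (past X t ω ++ [x]) ∂(env (past X t ω)).toMeasure ∂P := by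
  let _ : MeasurableSpace (List 𝒳) := ⊤
  have : DiscreteMeasurableSpace (List 𝒳) := ⟨fun _ => trivial⟩
  have hp : Measurable (past X t) :=
    measurable_to_countable' fun z => measurableSet_past_eq h.1 t z
  have hpx : Measurable fun ω => (past X t ω, X t ω) := hp.prodMk (h.1 t)
  have e1 : ∫⁻ ω, f (past X (t + 1) ω) ∂P =
      ∫⁻ y, f (y.1 ++ [y.2]) ∂(P.map fun ω => (past X t ω, X t ω)) := by
    rw [lintegral_map (Measurable.of_discrete) hpx]
    simp only [past_succ]
  have e2 : ∫⁻ ω, ∫⁻ x, f (past X t ω ++ [x]) ∂(env (past X t ω)).toMeasure ∂P =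
      ∫⁻ z, ∫⁻ x, f (z ++ [x]) ∂(env z).toMeasure ∂(P.map (past X t)) := by
    rw [lintegral_map (Measurable.of_discrete) hp]
  rw [e1, e2, lintegral_countable', lintegral_countable', ENNReal.tsum_prod']
  refine tsum_congr fun z => ?_
  rw [lintegral_countable', ← ENNReal.tsum_mul_right]
  refine tsum_congr fun x => ?_
  rw [Measure.map_apply hpx (measurableSet_singleton _),
    Measure.map_apply hp (measurableSet_singleton _),
    PMF.toMeasure_apply_singleton _ _ (measurableSet_singleton x)]
  have := h.measure_past_eq_and t z x
  have e3 : (fun ω => (past X t ω, X t ω)) ⁻¹' {(z, x)} = {ω | past X t ω = z ∧ X t ω = x} := by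
    ext ω; simp
  have e4 : past X t ⁻¹' {z} = {ω | past X t ω = z} := by ext ω; simp
  rw [e3, e4, this]
  ring

/-- Ville's inequality for nonnegative supermartingales that are functions of the past. -/
theorem IsGeneratedBy.measure_exists_one_le {env : List 𝒳 → PMF 𝒳} {P : Measure Ω}
    [IsProbabilityMeasure P] {X : ℕ → Ω → 𝒳} (h : IsGeneratedBy env P X)
    {M : List 𝒳 → ENNReal}
    (hM : ∀ z, ∫⁻ x, M (z ++ [x]) ∂(env z).toMeasure ≤ M z) :
    P {ω | ∃ t, 1 ≤ M (past X t ω)} ≤ M [] := by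
  -- Freezing at the value one, rather than at the value of `M` on crossing, keeps the
  -- supermartingale property and turns a crossing by time `n` into an event at time `n`, to which
  -- Markov's inequality applies.
  have hstep : ∀ z, ∫⁻ x, stopAtOne M (z ++ [x]) ∂(env z).toMeasure ≤ stopAtOne M z := by
    intro z
    by_cases hz : ∃ y, y <+: z ∧ 1 ≤ M y
    · have h1 : ∀ x, stopAtOne M (z ++ [x]) = 1 := by
        intro x
        obtain ⟨y, hy, hy'⟩ := hz
        exact if_pos ⟨y, hy.trans (List.prefix_append z [x]), hy'⟩
      have h2 : stopAtOne M z = 1 := if_pos hz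
      simp only [h1, h2, lintegral_one, measure_univ, le_refl]
    · have h1 : ∀ x, stopAtOne M (z ++ [x]) ≤ M (z ++ [x]) := by
        intro x
        unfold stopAtOne
        split_ifs with hx
        · obtain ⟨y, hy, hy'⟩ := hx
          rcases List.prefix_concat_iff.1 hy with rfl | h2
          · exact hy'
          · exact absurd ⟨y, h2, hy'⟩ hz
        · exact le_rfl
      refine (lintegral_mono h1).trans ((hM z).trans ?_)
      simp [stopAtOne, if_neg hz]
  have hmean : ∀ n, ∫⁻ ω, stopAtOne M (past X n ω) ∂P ≤ M [] := by
    intro n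
    induction n with
    | zero =>
      have : stopAtOne M [] ≤ M [] := by
        unfold stopAtOne
        split_ifs with hx
        · obtain ⟨y, hy, hy'⟩ := hx
          rw [List.prefix_nil.1 hy] at hy'
          exact hy'
        · exact le_rfl
      simpa [past] using this
    | succ n ih =>
      rw [h.lintegral_past_succ]
      exact (lintegral_mono fun ω => hstep _).trans ih
  have hprefix : ∀ {s t : ℕ} (ω : Ω), s ≤ t → past X s ω <+: past X t ω := by
    intro s t ω hst
    induction t, hst using Nat.le_induction with
    | base => exact List.prefix_rfl
    | succ t _ ih => rw [past_succ]; exact ih.trans (List.prefix_append _ _)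
  have hn : ∀ n, P {ω | ∃ t ≤ n, 1 ≤ M (past X t ω)} ≤ M [] := by
    intro n
    refine le_trans ?_ (hmean n)
    have hsub : {ω | ∃ t ≤ n, 1 ≤ M (past X t ω)} ⊆ {ω | 1 ≤ stopAtOne M (past X n ω)} := by
      rintro ω ⟨t, ht, hω⟩
      simp only [Set.mem_ofPred_eq, stopAtOne]
      rw [if_pos ⟨_, hprefix ω ht, hω⟩]
    refine (measure_mono hsub).trans ?_
    have hmeas : Measurable fun ω => stopAtOne M (past X n ω) := by
      let _ : MeasurableSpace (List 𝒳) := ⊤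
      have : DiscreteMeasurableSpace (List 𝒳) := ⟨fun _ => trivial⟩
      have hp : Measurable (past X n) :=
        measurable_to_countable' fun z => measurableSet_past_eq h.1 n z
      exact (Measurable.of_discrete (f := stopAtOne M)).comp hp
    simpa using mul_meas_ge_le_lintegral hmeas 1
  have hU : {ω | ∃ t, 1 ≤ M (past X t ω)} = ⋃ n, {ω | ∃ t ≤ n, 1 ≤ M (past X t ω)} := by
    ext ω
    simp only [Set.mem_ofPred_eq, Set.mem_iUnion]
    exact ⟨fun ⟨t, ht⟩ => ⟨t, t, le_rfl, ht⟩, fun ⟨_, t, _, ht⟩ => ⟨t, ht⟩⟩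
  rw [hU, Monotone.measure_iUnion]
  · exact iSup_le hn
  · intro m n hmn ω
    rintro ⟨t, ht, hω⟩
    exact ⟨t, ht.trans hmn, hω⟩

end GeneratedPaths

/-! ### The statistics of the monitor as functions of the state sequence. -/

/-- The weighted average of the scores `s` along a finite sequence, zero at weighted time zero. -/
noncomputable def runningMean {𝒳 : Type*} (α : List 𝒳 → ℝ) (s : List 𝒳 → 𝒳 → ℝ)
    (z : List 𝒳) : ℝ :=
  1 / weightedTime α z * pathSum s z

/-- The variance process of the monitor along a finite sequence. -/
noncomputable def variation {𝒳 : Type*} (α : List 𝒳 → ℝ) (s : List 𝒳 → 𝒳 → ℝ)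
    (z : List 𝒳) : ℝ :=
  1 + pathSum (fun y x => (s y x - runningMean α s y) ^ 2) z

/-- The iterated-logarithm term of the monitor. -/
noncomputable def logTerm (κ δ N : ℝ) : ℝ :=
  2 * Real.log (Real.pi * Real.log (κ * N) / √6) + Real.log (2 / δ)

/-- The half-width of the interval of the monitor, times the weighted time. -/
noncomputable def boundary (σ N g : ℝ) : ℝ :=
  √(2.13 * N * g + 1.76 * (σ * σ) * (g * g)) + 1.33 * σ * g

theorem pathSum_nonneg {𝒳 : Type*} {f : List 𝒳 → 𝒳 → ℝ} (hf : ∀ z x, 0 ≤ f z x)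
    (z : List 𝒳) : 0 ≤ pathSum f z := by
  induction z using List.reverseRecOn with
  | nil => simp
  | append_singleton z x ih => rw [pathSum_append_singleton]; exact add_nonneg ih (hf z x)

theorem one_le_variation {𝒳 : Type*} (α : List 𝒳 → ℝ) (s : List 𝒳 → 𝒳 → ℝ)
    (z : List 𝒳) : 1 ≤ variation α s z := by
  have := pathSum_nonneg (fun y x => sq_nonneg (s y x - runningMean α s y)) z
  unfold variation; linarith

theorem weightedTime_nonneg {𝒳 : Type*} {α : List 𝒳 → ℝ} (hα : ∀ z, 0 ≤ α z) (z : List 𝒳) :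
    0 ≤ weightedTime α z :=
  Finset.sum_nonneg fun _ _ => hα _

theorem pathSum_eq_zero_of_weightedTime {𝒳 : Type*} {α : List 𝒳 → ℝ} (hα : ∀ z, 0 ≤ α z)
    {s : List 𝒳 → 𝒳 → ℝ} (hs : ∀ z x, α z = 0 → s z x = 0) {z : List 𝒳}
    (hz : weightedTime α z = 0) : pathSum s z = 0 := by
  induction z using List.reverseRecOn with
  | nil => simp
  | append_singleton z x ih =>
    rw [weightedTime_append_singleton] at hz
    have h1 := weightedTime_nonneg hα z
    have h2 := hα z
    rw [pathSum_append_singleton, ih (by linarith), hs z x (by linarith), add_zero]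

/-- At weighted time zero every past weight vanishes, hence every past score, so the recursive
update of the mean is correct there too, despite the division by zero. -/
theorem weightedTime_mul_runningMean {𝒳 : Type*} {α : List 𝒳 → ℝ} (hα : ∀ z, 0 ≤ α z)
    {s : List 𝒳 → 𝒳 → ℝ} (hs : ∀ z x, α z = 0 → s z x = 0) (z : List 𝒳) :
    weightedTime α z * runningMean α s z = pathSum s z := by
  by_cases hz : weightedTime α z = 0
  · rw [hz, zero_mul, pathSum_eq_zero_of_weightedTime hα hs hz]
  · unfold runningMean; field_simp

theorem observedHistory_succ {Ω 𝒳 : Type*} (model : List 𝒳 → PMF 𝒳) (X : ℕ → Ω → 𝒳) (t : ℕ)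
    (ω : Ω) : observedHistory model X (t + 1) ω =
      observedHistory model X t ω ++ [(model (past X t ω), X t ω)] := by
  simp [observedHistory, List.range_succ]

theorem Expr.stack_sub (e₁ e₂ : Expr) :
    (e₁ - e₂).stack = Max.max e₁.stack (e₂.stack + 1) := rfl

theorem Expr.steps_sub {𝒳 : Type*} (β : List 𝒳 → 𝒳 → ℝ) (τ : SubroutineTimes 𝒳)
    (i : PMF 𝒳 × 𝒳) (S : State 𝒳) (e₁ e₂ : Expr) :
    (e₁ - e₂).steps β τ i S = e₁.steps β τ i S + e₂.steps β τ i S + 1 := rfl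

theorem Expr.stack_div (e₁ e₂ : Expr) :
    (e₁ / e₂).stack = Max.max e₁.stack (e₂.stack + 1) := rfl

theorem Expr.steps_div {𝒳 : Type*} (β : List 𝒳 → 𝒳 → ℝ) (τ : SubroutineTimes 𝒳)
    (i : PMF 𝒳 × 𝒳) (S : State 𝒳) (e₁ e₂ : Expr) :
    (e₁ / e₂).steps β τ i S = e₁.steps β τ i S + e₂.steps β τ i S + 1 := rfl

/-! ### The program computes these statistics; its time and space. -/

section Monitor

variable {𝒳 : Type*} (ℓ : (𝒳 → ℝ) → PMF 𝒳 → 𝒳 → ℝ) (α : List 𝒳 → ℝ) (β : List 𝒳 → 𝒳 → ℝ)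
  (a b cα cβ κ δ : ℝ)

theorem monitorState_append_singleton (w : List (PMF 𝒳 × 𝒳)) (i : PMF 𝒳 × 𝒳) :
    monitorState ℓ α β a b cα cβ κ δ (w ++ [i]) =
      runProgram ℓ α β i (monitorProgram κ δ) (monitorState ℓ α β a b cα cβ κ δ w) := by
  simp [monitorState]

theorem monitorState_list (w : List (PMF 𝒳 × 𝒳)) :
    (monitorState ℓ α β a b cα cβ κ δ w).list = w.map Prod.snd := by
  induction w using List.reverseRecOn with
  | nil => rfl
  | append_singleton w i ih =>
    rw [monitorState_append_singleton, List.map_append, ← ih]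
    rfl

theorem monitorState_observedHistory_list {Ω : Type*} (model : List 𝒳 → PMF 𝒳)
    (X : ℕ → Ω → 𝒳) (t : ℕ) (ω : Ω) :
    (monitorState ℓ α β a b cα cβ κ δ (observedHistory model X t ω)).list = past X t ω := by
  rw [monitorState_list]
  simp [observedHistory, past]

section Run

variable (i : PMF 𝒳 × 𝒳) (S : State 𝒳)

theorem runProgram_sigma :
    (runProgram ℓ α β i (monitorProgram κ δ) S).reg .sigma = S.reg .sigma := rfl

theorem runProgram_time :
    (runProgram ℓ α β i (monitorProgram κ δ) S).reg .time = S.reg .time + α S.list := rfl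

theorem runProgram_var :
    (runProgram ℓ α β i (monitorProgram κ δ) S).reg .var =
      max 1 (S.reg .var + (α S.list * ℓ (β S.list) i.1 i.2 - S.reg .mean) *
        (α S.list * ℓ (β S.list) i.1 i.2 - S.reg .mean)) := rfl

theorem runProgram_mean :
    (runProgram ℓ α β i (monitorProgram κ δ) S).reg .mean =
      1 / (S.reg .time + α S.list) * ((S.reg .time + α S.list - α S.list) * S.reg .mean +
        α S.list * ℓ (β S.list) i.1 i.2) := rfl

theorem runProgram_lower :
    (runProgram ℓ α β i (monitorProgram κ δ) S).reg .lower =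
      (runProgram ℓ α β i (monitorProgram κ δ) S).reg .mean -
        boundary (S.reg .sigma) ((runProgram ℓ α β i (monitorProgram κ δ) S).reg .var)
          (logTerm κ δ ((runProgram ℓ α β i (monitorProgram κ δ) S).reg .var)) /
          (runProgram ℓ α β i (monitorProgram κ δ) S).reg .time := rfl

theorem runProgram_upper :
    (runProgram ℓ α β i (monitorProgram κ δ) S).reg .upper =
      (runProgram ℓ α β i (monitorProgram κ δ) S).reg .mean +
        boundary (S.reg .sigma) ((runProgram ℓ α β i (monitorProgram κ δ) S).reg .var)
          (logTerm κ δ ((runProgram ℓ α β i (monitorProgram κ δ) S).reg .var)) /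
          (runProgram ℓ α β i (monitorProgram κ δ) S).reg .time := rfl

end Run

theorem monitorState_sigma (w : List (PMF 𝒳 × 𝒳)) :
    (monitorState ℓ α β a b cα cβ κ δ w).reg .sigma = cα * cβ * (b - a) := by
  induction w using List.reverseRecOn with
  | nil => rfl
  | append_singleton w i ih => rw [monitorState_append_singleton, runProgram_sigma, ih]

theorem monitorState_time {Ω : Type*} (model : List 𝒳 → PMF 𝒳) (X : ℕ → Ω → 𝒳) (t : ℕ)
    (ω : Ω) :
    (monitorState ℓ α β a b cα cβ κ δ (observedHistory model X t ω)).reg .time =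
      weightedTime α (past X t ω) := by
  induction t with
  | zero => simp [observedHistory, past, monitorState, initialState, weightedTime]
  | succ t ih =>
    rw [observedHistory_succ, monitorState_append_singleton, runProgram_time, ih, past_succ,
      weightedTime_append_singleton, monitorState_observedHistory_list]

/-- The weighted score of the model at the next state. -/
def pathScore (model : List 𝒳 → PMF 𝒳) (z : List 𝒳) (x : 𝒳) : ℝ :=
  α z * ℓ (β z) (model z) x

theorem monitorState_mean {Ω : Type*} (hα : ∀ z, 0 ≤ α z) (model : List 𝒳 → PMF 𝒳)
    (X : ℕ → Ω → 𝒳) (t : ℕ) (ω : Ω) :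
    (monitorState ℓ α β a b cα cβ κ δ (observedHistory model X t ω)).reg .mean =
      runningMean α (pathScore ℓ α β model) (past X t ω) := by
  induction t with
  | zero => simp [observedHistory, past, monitorState, initialState, runningMean]
  | succ t ih =>
    rw [observedHistory_succ, monitorState_append_singleton, runProgram_mean, ih, past_succ,
      monitorState_time, monitorState_observedHistory_list, add_sub_cancel_right,
      weightedTime_mul_runningMean hα (fun z x h => by simp [pathScore, h])]
    simp [runningMean, pathScore]

theorem monitorState_var {Ω : Type*} (hα : ∀ z, 0 ≤ α z) (model : List 𝒳 → PMF 𝒳)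
    (X : ℕ → Ω → 𝒳) (t : ℕ) (ω : Ω) :
    (monitorState ℓ α β a b cα cβ κ δ (observedHistory model X t ω)).reg .var =
      variation α (pathScore ℓ α β model) (past X t ω) := by
  induction t with
  | zero => simp [observedHistory, past, monitorState, initialState, variation]
  | succ t ih =>
    rw [observedHistory_succ, monitorState_append_singleton, runProgram_var, ih, past_succ,
      monitorState_mean _ _ _ _ _ _ _ _ _ hα, monitorState_observedHistory_list, ← sq]
    have h := one_le_variation α (pathScore ℓ α β model) (past X t ω)
    -- The maximum with one has no effect, since `N` starts at one and never decreases.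
    rw [max_eq_right (h.trans (le_add_of_nonneg_right (sq_nonneg _)))]
    simp [variation, pathScore, add_assoc]

theorem mem_weightedMonitor_iff {Ω : Type*} (hα : ∀ z, 0 ≤ α z) (model : List 𝒳 → PMF 𝒳)
    (X : ℕ → Ω → 𝒳) {t : ℕ} (ht : 1 ≤ t) (ω : Ω) (y : ℝ) :
    y ∈ weightedMonitor ℓ α β a b cα cβ κ δ (observedHistory model X t ω) ↔
      |y - runningMean α (pathScore ℓ α β model) (past X t ω)| ≤
        boundary (cα * cβ * (b - a)) (variation α (pathScore ℓ α β model) (past X t ω))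
          (logTerm κ δ (variation α (pathScore ℓ α β model) (past X t ω))) /
          weightedTime α (past X t ω) := by
  obtain ⟨t, rfl⟩ := Nat.exists_eq_succ_of_ne_zero (by omega : t ≠ 0)
  rw [weightedMonitor, ← monitorState_mean ℓ α β a b cα cβ κ δ hα,
    ← monitorState_var ℓ α β a b cα cβ κ δ hα, ← monitorState_time ℓ α β a b cα cβ κ δ model,
    Nat.succ_eq_add_one, observedHistory_succ, monitorState_append_singleton, runProgram_lower,
    runProgram_upper, monitorState_sigma, Set.mem_Icc, abs_le]
  constructor <;> rintro ⟨h1, h2⟩ <;> constructor <;> linarith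

theorem weightedExpectedScore_hiddenHistory [MeasurableSpace 𝒳] {Ω : Type*}
    (env model : List 𝒳 → PMF 𝒳) (X : ℕ → Ω → 𝒳) (t : ℕ) (ω : Ω) :
    weightedExpectedScore ℓ α β (hiddenHistory env model X t ω) =
      1 / weightedTime α (past X t ω) *
        pathSum (fun z _ => ∫ x, pathScore ℓ α β model z x ∂(env z).toMeasure) (past X t ω) := by
  have hmap : (hiddenHistory env model X t ω).map (fun e => e.2.2) = past X t ω := by
    simp [hiddenHistory, past]
  have hlen : (hiddenHistory env model X t ω).length = t := by simp [hiddenHistory]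
  have htake : ∀ i ≤ t, ((hiddenHistory env model X t ω).take i).map (fun e => e.2.2) =
      past X i ω := by
    intro i hi
    simp [hiddenHistory, past, ← List.map_take, List.take_range, hi]
  have hget : ∀ (i : ℕ) (h : i < (hiddenHistory env model X t ω).length),
      (hiddenHistory env model X t ω)[i] = (model (past X i ω), env (past X i ω), X i ω) := by
    intro i h
    simp [hiddenHistory]
  have hsum : ∀ t, pathSum (fun z _ => ∫ x, pathScore ℓ α β model z x ∂(env z).toMeasure)
      (past X t ω) = ∑ i ∈ Finset.range t,
        ∫ x, pathScore ℓ α β model (past X i ω) x ∂(env (past X i ω)).toMeasure := by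
    intro t
    induction t with
    | zero => simp [past]
    | succ t ih => rw [past_succ, pathSum_append_singleton, ih, Finset.sum_range_succ]
  rw [weightedExpectedScore, hmap, hsum]
  congr 1
  trans ∑ i ∈ Finset.range (hiddenHistory env model X t ω).length,
      ∫ x, pathScore ℓ α β model (past X i ω) x ∂(env (past X i ω)).toMeasure
  · rw [← Fin.sum_univ_eq_sum_range]
    refine Finset.sum_congr rfl fun i _ => ?_
    have hi : (i : ℕ) < t := i.2.trans_eq hlen
    rw [htake i hi.le, ← integral_const_mul, Fin.getElem_fin, hget]
    rfl
  · rw [hlen]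

/-- Each subroutine is called once per iteration: the two weight functions account for `2 * K`, and
100 generously covers the arithmetic. -/
theorem iterationTime_le {cβ' : ℝ} (hβ : ∀ z x, β z x ∈ Set.Icc 0 cβ') (τ : SubroutineTimes 𝒳)
    {K T : ℕ} (h1 : ∀ z, τ.predTime z ≤ K * (z.length + 1))
    (h2 : ∀ z, τ.outTime z ≤ K * (z.length + 1))
    (h3 : ∀ ω : 𝒳 → ℝ, (∀ x, ω x ∈ Set.Icc 0 cβ') → ∀ y x, τ.scoreTime ω y x ≤ T)
    (w : List (PMF 𝒳 × 𝒳)) (i : PMF 𝒳 × 𝒳) :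
    iterationTime ℓ α β a b cα cβ κ δ τ w i ≤ (2 * K + 100) * ((w.length + 1) + T) := by
  set S := monitorState ℓ α β a b cα cβ κ δ w with hS
  have hl : S.list.length = w.length := by rw [hS, monitorState_list, List.length_map]
  have : iterationTime ℓ α β a b cα cβ κ δ τ w i ≤
      τ.predTime S.list + (τ.outTime S.list + τ.scoreTime (β S.list) i.1 i.2) + 100 := by
    simp only [iterationTime, programTime, monitorProgram, Instr.steps, Instr.exec, Expr.steps,
      Expr.steps_sub, Expr.steps_div, ← hS]
    omega
  have e1 := h1 S.list
  have e2 := h2 S.list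
  have e3 := h3 (β S.list) (hβ _) i.1 i.2
  rw [hl] at e1 e2
  nlinarith

theorem iterationSpace_le (w : List (PMF 𝒳 × 𝒳)) (i : PMF 𝒳 × 𝒳) :
    iterationSpace ℓ α β a b cα cβ κ δ w i ≤ 100 * (w.length + 1) := by
  have hl : (monitorState ℓ α β a b cα cβ κ δ w).list.length = w.length := by
    rw [monitorState_list, List.length_map]
  have hc : Fintype.card Reg = 10 := rfl
  simp [iterationSpace, programSpace, monitorProgram, Instr.cells, Instr.exec, Expr.stack,
    Expr.stack_sub, Expr.stack_div, hl, hc]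
  omega

end Monitor

/-! ### The mixture supermartingale. -/

theorem pathSum_sub_const_mul {𝒳 : Type*} (f g : List 𝒳 → 𝒳 → ℝ) (k : ℝ) (z : List 𝒳) :
    pathSum (fun y x => f y x - k * g y x) z = pathSum f z - k * pathSum g z := by
  induction z using List.reverseRecOn with
  | nil => simp
  | append_singleton z x ih => simp only [pathSum_append_singleton, ih]; ring

theorem pathSum_sub {𝒳 : Type*} (f g : List 𝒳 → 𝒳 → ℝ) (z : List 𝒳) :
    pathSum (fun y x => f y x - g y x) z = pathSum f z - pathSum g z := by
  simpa using pathSum_sub_const_mul f g 1 z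

theorem pathSum_neg {𝒳 : Type*} (f : List 𝒳 → 𝒳 → ℝ) (z : List 𝒳) :
    pathSum (fun y x => -f y x) z = -pathSum f z := by
  induction z using List.reverseRecOn with
  | nil => simp
  | append_singleton z x ih => simp only [pathSum_append_singleton, ih]; ring

section Supermartingale

variable {𝒳 : Type*} [MeasurableSpace 𝒳]

/-- The deviation of the next score from its conditional expectation. -/
noncomputable def deviation (env : List 𝒳 → PMF 𝒳) (s : List 𝒳 → 𝒳 → ℝ) (z : List 𝒳)
    (x : 𝒳) : ℝ :=
  s z x - ∫ y, s z y ∂(env z).toMeasure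

/-- The empirical Bernstein supermartingale of the scores `s` with predictions `p`, at the
parameter `θ / (1 + c θ)`. -/
noncomputable def bernsteinProcess (env : List 𝒳 → PMF 𝒳) (c θ : ℝ) (s : List 𝒳 → 𝒳 → ℝ)
    (p : List 𝒳 → ℝ) (z : List 𝒳) : ENNReal :=
  ENNReal.ofReal (Real.exp (θ / (1 + c * θ) *
    pathSum (fun y x => deviation env s y x - θ / 2 * (s y x - p y) ^ 2) z))

theorem lintegral_bernsteinProcess_le [DiscreteMeasurableSpace 𝒳] (env : List 𝒳 → PMF 𝒳)
    {c θ : ℝ} (hθ : 0 ≤ θ) {s : List 𝒳 → 𝒳 → ℝ} (p : List 𝒳 → ℝ) {z : List 𝒳}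
    (hs : ∃ A B, B - A ≤ c ∧ ∀ x, s z x ∈ Set.Icc A B) :
    ∫⁻ x, bernsteinProcess env c θ s p (z ++ [x]) ∂(env z).toMeasure ≤
      bernsteinProcess env c θ s p z := by
  obtain ⟨A, B, hAB, hsz⟩ := hs
  simp only [bernsteinProcess, pathSum_append_singleton, mul_add, Real.exp_add]
  simp only [ENNReal.ofReal_mul (Real.exp_pos _).le]
  rw [lintegral_const_mul _ Measurable.of_discrete]
  exact mul_le_of_le_one_right zero_le (lintegral_exp_empirical_bernstein_le_one
    (env z).toMeasure Measurable.of_discrete (p z) hθ hAB hsz)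

/-- Dividing `r` by `θ / (1 + c * θ)` gives `r / θ + c * r`, which is how the linear term in `c`
enters the boundary. -/
theorem exp_le_bernsteinProcess (env : List 𝒳 → PMF 𝒳) {c θ r : ℝ} (hc : 0 ≤ c) (hθ : 0 < θ)
    {s : List 𝒳 → 𝒳 → ℝ} {p : List 𝒳 → ℝ} {z : List 𝒳}
    (h : r / θ + c * r + θ / 2 * pathSum (fun y x => (s y x - p y) ^ 2) z ≤
      pathSum (deviation env s) z) :
    ENNReal.ofReal (Real.exp r) ≤ bernsteinProcess env c θ s p z := by
  apply ENNReal.ofReal_le_ofReal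
  apply Real.exp_le_exp.2
  rw [pathSum_sub_const_mul]
  calc r = θ / (1 + c * θ) * (r / θ + c * r) := by field_simp
    _ ≤ _ := mul_le_mul_of_nonneg_left (by linarith) (by positivity)

/-- The weight of the `k`-th epoch in the mixture. -/
noncomputable def epochWeight (δ : ℝ) (k : ℕ) : ℝ :=
  δ / 2 * (6 / Real.pi ^ 2) * (1 / (k : ℝ) ^ 2)

/-- Basel sum; the term `k = 0` vanishes because `1 / 0 = 0`. Each of the two tails receives `δ /
2`. -/
theorem hasSum_epochWeight (δ : ℝ) : HasSum (epochWeight δ) (δ / 2) := by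
  have h := hasSum_zeta_two.mul_left (δ / 2 * (6 / Real.pi ^ 2))
  have e : δ / 2 * (6 / Real.pi ^ 2) * (Real.pi ^ 2 / 6) = δ / 2 := by
    have := Real.pi_ne_zero
    field_simp
  rwa [e] at h

theorem epochWeight_nonneg {δ : ℝ} (hδ : 0 ≤ δ) (k : ℕ) : 0 ≤ epochWeight δ k := by
  unfold epochWeight; positivity

theorem epochWeight_pos {δ : ℝ} (hδ : 0 < δ) {k : ℕ} (hk : 1 ≤ k) : 0 < epochWeight δ k := by
  have : (0 : ℝ) < k := by exact_mod_cast hk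
  have := Real.pi_pos
  unfold epochWeight; positivity

theorem epochWeight_lt_one {δ : ℝ} (hδ : 0 < δ) (hδ1 : δ < 1) {k : ℕ} (hk : 1 ≤ k) :
    epochWeight δ k < 1 := by
  have hk' : (1 : ℝ) ≤ k := by exact_mod_cast hk
  have h1 : 1 / (k : ℝ) ^ 2 ≤ 1 := by
    rw [div_le_one (by positivity)]; nlinarith
  have h2 : 6 / Real.pi ^ 2 ≤ 1 := by
    rw [div_le_one (by have := Real.pi_pos; positivity)]; nlinarith [Real.pi_gt_three]
  have h3 : δ / 2 * (6 / Real.pi ^ 2) ≤ δ / 2 := mul_le_of_le_one_right (by linarith) h2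
  have h4 : δ / 2 * (6 / Real.pi ^ 2) * (1 / (k : ℝ) ^ 2) ≤ δ / 2 * (6 / Real.pi ^ 2) :=
    mul_le_of_le_one_right (by positivity) h1
  unfold epochWeight; linarith

/-- The parameter `θ` of the `k`-th epoch `exp k ≤ κ v ≤ exp (k + 1)`. -/
noncomputable def epochParam (κ δ : ℝ) (k : ℕ) : ℝ :=
  √(2 * -Real.log (epochWeight δ k) / (Real.exp (k + 1 / 2) / κ))

/-- The inverse weight is `(π k / √6) ^ 2 * (2 / δ)`, so the iterated-logarithm term is the negative
log-weight with `k` replaced by `log (κ v)`. -/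
theorem neg_log_epochWeight_le_logTerm {κ δ v : ℝ} (hδ : 0 < δ) {k : ℕ} (hk : 1 ≤ k)
    (h : (k : ℝ) ≤ Real.log (κ * v)) : -Real.log (epochWeight δ k) ≤ logTerm κ δ v := by
  have hk' : (1 : ℝ) ≤ k := by exact_mod_cast hk
  have hpi := Real.pi_pos
  have hpos : 0 < Real.pi * (k : ℝ) / √6 := by positivity
  have e : -Real.log (epochWeight δ k) =
      2 * Real.log (Real.pi * (k : ℝ) / √6) + Real.log (2 / δ) := by
    have h6 : (√6 : ℝ) ^ 2 = 6 := Real.sq_sqrt (by norm_num)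
    have : (epochWeight δ k)⁻¹ = (Real.pi * (k : ℝ) / √6) ^ 2 * (2 / δ) := by
      rw [div_pow, h6, epochWeight]
      field_simp
    rw [← Real.log_inv, this, Real.log_mul (by positivity) (by positivity), Real.log_pow]
    norm_num
  rw [e, logTerm]
  have : Real.log (Real.pi * (k : ℝ) / √6) ≤ Real.log (Real.pi * Real.log (κ * v) / √6) :=
    Real.log_le_log hpos (by gcongr)
  linarith

/-- The mixture over the epochs of the supermartingales of both tails. -/
noncomputable def mixtureProcess (env : List 𝒳 → PMF 𝒳) (c κ δ : ℝ) (s : List 𝒳 → 𝒳 → ℝ)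
    (p : List 𝒳 → ℝ) (z : List 𝒳) : ENNReal :=
  ∑' k, ENNReal.ofReal (epochWeight δ k) * (bernsteinProcess env c (epochParam κ δ k) s p z +
    bernsteinProcess env c (epochParam κ δ k) (fun y x => -s y x) (fun y => -p y) z)

theorem mixtureProcess_nil (env : List 𝒳 → PMF 𝒳) (c κ : ℝ) {δ : ℝ} (hδ : 0 ≤ δ)
    (s : List 𝒳 → 𝒳 → ℝ) (p : List 𝒳 → ℝ) :
    mixtureProcess env c κ δ s p [] = ENNReal.ofReal δ := by
  simp only [mixtureProcess, bernsteinProcess, pathSum_nil, mul_zero, Real.exp_zero,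
    ENNReal.ofReal_one]
  rw [ENNReal.tsum_mul_right, ← ENNReal.ofReal_tsum_of_nonneg (epochWeight_nonneg hδ)
    (hasSum_epochWeight δ).summable, (hasSum_epochWeight δ).tsum_eq, one_add_one_eq_two,
    ← ENNReal.ofReal_ofNat, ← ENNReal.ofReal_mul (by positivity)]
  congr 1
  ring

theorem lintegral_mixtureProcess_le [DiscreteMeasurableSpace 𝒳]
    (env : List 𝒳 → PMF 𝒳) {c κ δ : ℝ} {s : List 𝒳 → 𝒳 → ℝ} (p : List 𝒳 → ℝ) {z : List 𝒳}
    (hs : ∃ A B, B - A ≤ c ∧ ∀ x, s z x ∈ Set.Icc A B) :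
    ∫⁻ x, mixtureProcess env c κ δ s p (z ++ [x]) ∂(env z).toMeasure ≤
      mixtureProcess env c κ δ s p z := by
  have hs' : ∃ A B, B - A ≤ c ∧ ∀ x, -s z x ∈ Set.Icc A B := by
    obtain ⟨A, B, hAB, h⟩ := hs
    exact ⟨-B, -A, by linarith, fun x => ⟨neg_le_neg (h x).2, neg_le_neg (h x).1⟩⟩
  unfold mixtureProcess
  rw [lintegral_tsum fun k => Measurable.of_discrete.aemeasurable]
  refine ENNReal.tsum_le_tsum fun k => ?_
  rw [lintegral_const_mul _ Measurable.of_discrete, lintegral_add_left Measurable.of_discrete]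
  gcongr
  · exact lintegral_bernsteinProcess_le env (Real.sqrt_nonneg _) p hs
  · exact lintegral_bernsteinProcess_le env (Real.sqrt_nonneg _) _ hs'

theorem deviation_neg (env : List 𝒳 → PMF 𝒳) (s : List 𝒳 → 𝒳 → ℝ) :
    deviation env (fun y x => -s y x) = fun y x => -deviation env s y x := by
  funext y x
  simp only [deviation, integral_neg]
  ring

theorem one_le_mixtureProcess (env : List 𝒳 → PMF 𝒳) {c κ δ v : ℝ} (hc : 0 ≤ c) (hκ : 0 < κ)
    (hδ : 0 < δ) (hδ1 : δ < 1) {s : List 𝒳 → 𝒳 → ℝ} {p : List 𝒳 → ℝ} {z : List 𝒳}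
    (hv : pathSum (fun y x => (s y x - p y) ^ 2) z ≤ v) (hv0 : 0 < v)
    (hκv : Real.exp 1 ≤ κ * v)
    (h : boundary c v (logTerm κ δ v) < |pathSum (deviation env s) z|) :
    1 ≤ mixtureProcess env c κ δ s p z := by
  have hlog : 1 ≤ Real.log (κ * v) := by
    rwa [Real.le_log_iff_exp_le (by positivity)]
  -- The epoch containing `v`. The hypothesis `hκv` excludes epoch zero, whose weight is zero.
  set k := ⌊Real.log (κ * v)⌋₊ with hk_def
  have hk : 1 ≤ k := Nat.le_floor (by simpa using hlog)
  have hk1 : (k : ℝ) ≤ Real.log (κ * v) := Nat.floor_le (by linarith)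
  have hk2 : Real.log (κ * v) ≤ k + 1 := (Nat.lt_floor_add_one _).le
  have hk1' : Real.exp k ≤ κ * v := (Real.le_log_iff_exp_le (by positivity)).1 hk1
  have hk2' : κ * v ≤ Real.exp (k + 1) := (Real.log_le_iff_le_exp (by positivity)).1 hk2
  set w := epochWeight δ k with hw
  have hw0 : 0 < w := epochWeight_pos hδ hk
  have hr : 0 < -Real.log w := neg_pos.2 (Real.log_neg hw0 (epochWeight_lt_one hδ hδ1 hk))
  have hg : -Real.log w ≤ logTerm κ δ v := neg_log_epochWeight_le_logTerm hδ hk hk1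
  set r := -Real.log w with hr_def
  set g := logTerm κ δ v
  set θ := epochParam κ δ k with hθ_def
  have hu : 0 < Real.exp (k + 1 / 2) / κ := by positivity
  have hθ : 0 < θ := Real.sqrt_pos.2 (by positivity)
  -- `exp (k + 1 / 2) / κ` is the geometric centre of the epoch, hence within a factor `√e` of `v`.
  have hst : r / θ + θ / 2 * v ≤ √(2.13 * v * r) := by
    refine stitched_boundary_le hr hv0 hu ?_ ?_
    · rw [div_le_iff₀ hκ, add_comm, Real.exp_add]
      calc _ ≤ Real.exp (1 / 2) * (κ * v) := by gcongr
        _ = _ := by ring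
    · rw [mul_div_assoc', le_div_iff₀ hκ, ← Real.exp_add]
      calc v * κ = κ * v := mul_comm _ _
        _ ≤ _ := hk2'
        _ = _ := by congr 1; ring
  have hbd : r / θ + c * r + θ / 2 * pathSum (fun y x => (s y x - p y) ^ 2) z ≤
      boundary c v g := by
    -- The argument yields the smaller boundary `√(2.13 v g) + c g`; the term with 1.76 and the
    -- excess of 1.33 over one are slack.
    have h1 : √(2.13 * v * r) ≤ √(2.13 * v * g + 1.76 * (c * c) * (g * g)) := by
      apply Real.sqrt_le_sqrt
      have : 2.13 * v * r ≤ 2.13 * v * g := mul_le_mul_of_nonneg_left hg (by positivity)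
      nlinarith [mul_self_nonneg (c * g)]
    have h2 : c * r ≤ 1.33 * c * g := by nlinarith [mul_nonneg hc hr.le]
    have h3 : θ / 2 * pathSum (fun y x => (s y x - p y) ^ 2) z ≤ θ / 2 * v :=
      mul_le_mul_of_nonneg_left hv (by positivity)
    unfold boundary
    linarith
  have hone : 1 = ENNReal.ofReal w * ENNReal.ofReal (Real.exp r) := by
    rw [← ENNReal.ofReal_mul hw0.le, hr_def, Real.exp_neg, Real.exp_log hw0,
      mul_inv_cancel₀ hw0.ne', ENNReal.ofReal_one]
  refine le_trans ?_ (ENNReal.le_tsum k)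
  rw [hone]
  gcongr
  -- The sign of the deviation selects the tail; the summand of epoch `k` alone already reaches `w *
  -- exp r = 1`.
  rcases lt_abs.1 (hbd.trans_lt h) with h' | h'
  · exact (exp_le_bernsteinProcess env hc hθ h'.le).trans le_self_add
  · refine (exp_le_bernsteinProcess env hc hθ ?_).trans le_add_self
    rw [deviation_neg, pathSum_neg]
    refine le_trans (le_of_eq ?_) h'.le
    congr 3
    funext y x
    ring

end Supermartingale

/-! ### Boundary crossing and soundness. -/

theorem pathScore_mem_Icc {𝒳 : Type*} {ℓ : (𝒳 → ℝ) → PMF 𝒳 → 𝒳 → ℝ} {α : List 𝒳 → ℝ}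
    {β : List 𝒳 → 𝒳 → ℝ} {a b cα cβ : ℝ} (hab : a ≤ b) (hcβ : 0 < cβ)
    (hℓ : ∀ ω : 𝒳 → ℝ, (∀ x, ω x ∈ Set.Icc 0 cβ) →
      ∀ y x, ℓ ω y x ∈ Set.Icc (cβ * a) (cβ * b))
    (hα : ∀ z, α z ∈ Set.Icc 0 cα) (hβ : ∀ z x, β z x ∈ Set.Icc 0 cβ)
    (model : List 𝒳 → PMF 𝒳) (z : List 𝒳) :
    ∃ A B, B - A ≤ cα * cβ * (b - a) ∧ ∀ x, pathScore ℓ α β model z x ∈ Set.Icc A B := by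
  refine ⟨α z * (cβ * a), α z * (cβ * b), ?_, fun x => ?_⟩
  · have : α z * (cβ * (b - a)) ≤ cα * (cβ * (b - a)) :=
      mul_le_mul_of_nonneg_right (hα z).2 (mul_nonneg hcβ.le (by linarith))
    linarith
  · have := hℓ _ (hβ z) (model z) x
    exact ⟨mul_le_mul_of_nonneg_left this.1 (hα z).1, mul_le_mul_of_nonneg_left this.2 (hα z).1⟩

section Soundness

variable {𝒳 : Type*} [Countable 𝒳] [MeasurableSpace 𝒳] [DiscreteMeasurableSpace 𝒳]

theorem IsGeneratedBy.measure_boundary_crossing_le {Ω : Type*} [MeasurableSpace Ω]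
    {env : List 𝒳 → PMF 𝒳} {P : Measure Ω} [IsProbabilityMeasure P] {X : ℕ → Ω → 𝒳}
    (h : IsGeneratedBy env P X) {c κ δ : ℝ} (hc : 0 ≤ c) (hκ : 0 < κ) (hδ : 0 < δ) (hδ1 : δ < 1)
    {α : List 𝒳 → ℝ} {s : List 𝒳 → 𝒳 → ℝ}
    (hs : ∀ z, ∃ A B, B - A ≤ c ∧ ∀ x, s z x ∈ Set.Icc A B) :
    P {ω | ∃ t, Real.exp 1 ≤ κ * variation α s (past X t ω) ∧
      boundary c (variation α s (past X t ω)) (logTerm κ δ (variation α s (past X t ω))) <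
        |pathSum (deviation env s) (past X t ω)|} ≤ ENNReal.ofReal δ := by
  rw [← mixtureProcess_nil env c κ hδ.le s (runningMean α s)]
  refine le_trans (measure_mono ?_)
    (h.measure_exists_one_le fun z => lintegral_mixtureProcess_le env (runningMean α s) (hs z))
  rintro ω ⟨t, h1, h2⟩
  refine ⟨t, one_le_mixtureProcess env hc hκ hδ hδ1 ?_ ?_ h1 h2⟩
  · simp [variation]
  · linarith [one_le_variation α s (past X t ω)]

theorem IsGeneratedBy.weightedMonitor_sound {Ω : Type*} [MeasurableSpace Ω]
    {env : List 𝒳 → PMF 𝒳} {P : Measure Ω} [IsProbabilityMeasure P] {X : ℕ → Ω → 𝒳}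
    (h : IsGeneratedBy env P X) (model : List 𝒳 → PMF 𝒳)
    {ℓ : (𝒳 → ℝ) → PMF 𝒳 → 𝒳 → ℝ} {α : List 𝒳 → ℝ}
    {β : List 𝒳 → 𝒳 → ℝ} {a b cα cβ κ δ : ℝ} (hab : a ≤ b) (hcα : 0 < cα) (hcβ : 0 < cβ)
    (hκ : 0 < κ) (hδ : 0 < δ) (hδ1 : δ < 1)
    (hℓ : ∀ ω : 𝒳 → ℝ, (∀ x, ω x ∈ Set.Icc 0 cβ) →
      ∀ y x, ℓ ω y x ∈ Set.Icc (cβ * a) (cβ * b))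
    (hα : ∀ z, α z ∈ Set.Icc 0 cα) (hβ : ∀ z x, β z x ∈ Set.Icc 0 cβ) :
    ENNReal.ofReal (1 - δ) ≤
      P {ω | ∀ t : ℕ, 1 ≤ t → 0 < weightedTime α (past X t ω) →
        Real.exp 1 ≤ κ *
          (monitorState ℓ α β a b cα cβ κ δ (observedHistory model X t ω)).reg Reg.var →
        weightedExpectedScore ℓ α β (hiddenHistory env model X t ω) ∈
          weightedMonitor ℓ α β a b cα cβ κ δ (observedHistory model X t ω)} := by
  have hα0 : ∀ z, 0 ≤ α z := fun z => (hα z).1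
  have hc : 0 ≤ cα * cβ * (b - a) := mul_nonneg (by positivity) (by linarith)
  have hbad := h.measure_boundary_crossing_le hc hκ hδ hδ1 (α := α)
    (pathScore_mem_Icc hab hcβ hℓ hα hβ model)
  rw [ENNReal.ofReal_sub _ hδ.le, ENNReal.ofReal_one, tsub_le_iff_right, ← measure_univ (μ := P)]
  -- Subadditivity on an event and its complement suffices, so the event of coverage need not be
  -- shown measurable.
  refine (measure_univ_le_add_compl _).trans (add_le_add le_rfl (le_trans (measure_mono ?_) hbad))
  intro ω hω
  simp only [Set.mem_compl_iff, Set.mem_ofPred_eq, not_forall] at hω ⊢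
  obtain ⟨t, ht, hpos, hvar, hmem⟩ := hω
  rw [monitorState_var _ _ _ _ _ _ _ _ _ hα0] at hvar
  refine ⟨t, hvar, ?_⟩
  rw [mem_weightedMonitor_iff _ _ _ _ _ _ _ _ _ hα0 _ _ ht, not_le,
    weightedExpectedScore_hiddenHistory, runningMean, ← mul_sub, abs_mul, abs_of_pos (by positivity),
    one_div_mul_eq_div, div_lt_div_iff_of_pos_right hpos, abs_sub_comm, ← pathSum_sub] at hmem
  exact hmem

end Soundness

end AlignmentMonitor

theorem theorem3 (K : ℕ) :
    ∃ C : ℕ,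
      ∀ {𝒳 : Type*} [Countable 𝒳] [MeasurableSpace 𝒳] [DiscreteMeasurableSpace 𝒳]
        (ℓ : (𝒳 → ℝ) → PMF 𝒳 → 𝒳 → ℝ) (α : List 𝒳 → ℝ) (β : List 𝒳 → 𝒳 → ℝ)
        (a b cα cβ δ : ℝ),
        a ≤ b → 0 < cα → 0 < cβ → δ ∈ Set.Ioo (0 : ℝ) 1 →
        (∀ ω : 𝒳 → ℝ, (∀ x, ω x ∈ Set.Icc 0 cβ) →
          ∀ y x, ℓ ω y x ∈ Set.Icc (cβ * a) (cβ * b)) →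
        (∀ z, α z ∈ Set.Icc 0 cα) →
        (∀ z x, β z x ∈ Set.Icc 0 cβ) →
        -- Soundness of the monitor, for every environment, every model and every realisation of
        -- the process that they define.
        (∀ (env model : List 𝒳 → PMF 𝒳) {Ω : Type*} [MeasurableSpace Ω] (P : Measure Ω)
            [IsProbabilityMeasure P] (X : ℕ → Ω → 𝒳), IsGeneratedBy env P X →
          ENNReal.ofReal (1 - δ) ≤
              P {ω | ∀ t : ℕ, 1 ≤ t → 0 < weightedTime α (past X t ω) →
                weightedExpectedScore ℓ α β (hiddenHistory env model X t ω) ∈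
                  weightedMonitor ℓ α β a b cα cβ (Real.exp 1) δ (observedHistory model X t ω)} ∧
          -- With `log N` in place of `log (e N)` the same holds at all times at which `N ≥ e`.
          ENNReal.ofReal (1 - δ) ≤
              P {ω | ∀ t : ℕ, 1 ≤ t → 0 < weightedTime α (past X t ω) →
                Real.exp 1 ≤
                  (monitorState ℓ α β a b cα cβ 1 δ (observedHistory model X t ω)).reg Reg.var →
                weightedExpectedScore ℓ α β (hiddenHistory env model X t ω) ∈
                  weightedMonitor ℓ α β a b cα cβ 1 δ (observedHistory model X t ω)}) ∧
        -- Time and space of the iteration at time `t = w.length + 1`, when the weight functions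
        -- are evaluated in linear time and the scoring rule in time `T`.
        (∀ (κ : ℝ) (τ : SubroutineTimes 𝒳) (T : ℕ),
          (∀ z, τ.predTime z ≤ K * (z.length + 1)) →
          (∀ z, τ.outTime z ≤ K * (z.length + 1)) →
          (∀ ω : 𝒳 → ℝ, (∀ x, ω x ∈ Set.Icc 0 cβ) → ∀ y x, τ.scoreTime ω y x ≤ T) →
          ∀ (w : List (PMF 𝒳 × 𝒳)) (i : PMF 𝒳 × 𝒳),
            iterationTime ℓ α β a b cα cβ κ δ τ w i ≤ C * ((w.length + 1) + T) ∧
            iterationSpace ℓ α β a b cα cβ κ δ w i ≤ C * (w.length + 1)) := by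
  refine ⟨2 * K + 100, ?_⟩
  intro 𝒳 _ _ _ ℓ α β a b cα cβ δ hab hcα hcβ hδ hℓ hα hβ
  refine ⟨?_, ?_⟩
  · intro env model Ω _ P _ X hX
    refine ⟨?_, ?_⟩
    · refine (hX.weightedMonitor_sound model hab hcα hcβ (Real.exp_pos 1) hδ.1 hδ.2 hℓ hα
        hβ).trans (measure_mono ?_)
      intro ω hω t ht hpos
      refine hω t ht hpos ?_
      rw [monitorState_var _ _ _ _ _ _ _ _ _ fun z => (hα z).1]
      -- With `κ = e`, the bound `N ≥ 1` places every time in an epoch `k ≥ 1`; with `κ = 1` this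
      -- requires `N ≥ e`.
      exact le_mul_of_one_le_right (Real.exp_pos 1).le (one_le_variation _ _ _)
    · simpa only [one_mul] using
        hX.weightedMonitor_sound model hab hcα hcβ one_pos hδ.1 hδ.2 hℓ hα hβ
  · intro κ τ T h1 h2 h3 w i
    refine ⟨iterationTime_le ℓ α β a b cα cβ κ δ hβ τ h1 h2 h3 w i,
      (iterationSpace_le ℓ α β a b cα cβ κ δ w i).trans ?_⟩
    exact Nat.mul_le_mul_right _ (by omega)
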